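/- Let $\mathcal X\subset\mathbb R^d$ be nonempty and compact, $|\mathcal X|:=\max_{x\in\mathcal X}\|x\|$, $b\in\mathbb R^m$, $\alpha>0$, and let $C\in\mathbb R^{m\times d}$ have $\mathrm{rank}(C)=d$. Write $\|C\|$ for the spectral norm of $C$ and $\sigma_{\min}(C)=\sqrt{\lambda_{\min}(C^TC)}$. For a Borel probability measure $\nu$ on $\mathcal X$ put $$L_\nu(y)=\log\int_{\mathcal X}e^{\langle y,x\rangle}\,d\nu(x),\qquad \phi_\nu(z)=\frac1{2\alpha}\|z\|^2-\langle b,z\rangle+L_\nu(C^Tz),$$ $$\kappa_\nu(x)=\inf\Big\{\mathrm{KL}(Q\,\Vert\,\nu)\,:\,Q\text{ a Borel probability measure on }\mathcal X,\ \int_{\mathcal X} y\,dQ(y)=x\Big\},$$ and for $\varepsilon\ge 0$ let $S_\varepsilon(\nu)=\{z\in\mathbb R^m:\phi_\nu(z)\le\inf\phi_\nu+\varepsilon\}$. Let $X_1,X_2,\dots$ be i.i.d. $\mathcal X$-valued random vectors on a probability space $(\Omega,\mathcal F,\mathbb P)$ with law $\mu$, and let $\mu_n^{(\omega)}=\frac1n\sum_{i=1}^n\delta_{X_i(\omega)}$.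 **Theorem.** The problem $\min_{x\in\mathbb R^d}\ \frac{\alpha}{2}\|b-Cx\|^2+\kappa_\mu(x)$ has a unique solution $\overline x_\mu$. For every $n\ge1$, every $\varepsilon\ge0$ and every measurable selection $\overline z_{n,\varepsilon}(\omega)\in S_\varepsilon(\mu_n^{(\omega)})$, the vector $\overline x_{n,\varepsilon}(\omega)=\nabla L_{\mu_n^{(\omega)}}(C^T\overline z_{n,\varepsilon}(\omega))$ satisfies $$\mathbb E_{\mathbb P}\|\overline x_{n,\varepsilon}-\overline x_\mu\|\le\frac{DK_1}{\alpha\,\sigma_{\min}(C)}\frac1{\sqrt n}+\frac{2D\sqrt{2K_1}}{\sqrt\alpha\,\sigma_{\min}(C)}\sqrt{\frac1{\sqrt n}}+\Big(K_2\|C\|\sqrt{2\alpha}+\frac{2}{\sqrt\alpha\,\sigma_{\min}(C)}\Big)\sqrt\varepsilon,$$ where the constants $K_1,K_2,D>0$ depend only on $|\mathcal X|,\|C\|,b,\varepsilon,\alpha,d$ (and on $m$, through $b\in\mathbb R^m$). In particular $$\mathbb E_{\mathbb P}\|\overline x_{n,\varepsilon}-\overline x_\mu\|= O\big(n^{-1/4}+\sqrt\varepsilon\big),$$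 that is, it is at most $M\,(n^{-1/4}+\sqrt\varepsilon)$ for all $n\ge1$ and $\varepsilon\ge0$, with a constant $M$ that depends only on $|\mathcal X|,\|C\|,\sigma_{\min}(C),b,\alpha,d$. -/

import Mathlib

open MeasureTheory ProbabilityTheory
open scoped ENNReal RealInnerProductSpace

universe u

namespace MEM

noncomputable section

variable {d m : ℕ}

/-- The matrix-vector product `C x`, between Euclidean spaces. -/
def mulVec (C : Matrix (Fin m) (Fin d) ℝ) (x : EuclideanSpace ℝ (Fin d)) :
    EuclideanSpace ℝ (Fin m) :=
  Matrix.toEuclideanLin C x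

/-- The spectral norm of `C`: its operator norm between Euclidean spaces. -/
def specNorm (C : Matrix (Fin m) (Fin d) ℝ) : ℝ :=
  ‖(Matrix.toEuclideanLin C).toContinuousLinearMap‖

/-- The smallest singular value of `C`: the square root of the least eigenvalue of `Cᵀ C`. -/
def sigmaMin (C : Matrix (Fin m) (Fin d) ℝ) : ℝ :=
  Real.sqrt (⨅ i, (Matrix.isHermitian_conjTranspose_mul_self C).eigenvalues i)

/-- `Q` is a Borel probability measure on `𝒳`, seen as a measure on `ℝᵈ` carried by `𝒳`. -/
def IsProbOn (𝒳 : Set (EuclideanSpace ℝ (Fin d))) (Q : Measure (EuclideanSpace ℝ (Fin d))) :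
    Prop :=
  IsProbabilityMeasure Q ∧ Q 𝒳ᶜ = 0

/-- The moment generating function `y ↦ ∫ exp ⟨y, x⟩ dν(x)`. -/
def momentGen (ν : Measure (EuclideanSpace ℝ (Fin d))) (y : EuclideanSpace ℝ (Fin d)) : ℝ :=
  ∫ x, Real.exp ⟪y, x⟫ ∂ν

/-- The log-moment generating function. -/
def logMomentGen (ν : Measure (EuclideanSpace ℝ (Fin d))) (y : EuclideanSpace ℝ (Fin d)) : ℝ :=
  Real.log (momentGen ν y)

/-- The maximum entropy on the mean function: the least Kullback-Leibler divergence from `μ`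
of a probability measure on `𝒳` with mean `y` (`∞` if there is none). -/
def kappa (𝒳 : Set (EuclideanSpace ℝ (Fin d))) (μ : Measure (EuclideanSpace ℝ (Fin d)))
    (y : EuclideanSpace ℝ (Fin d)) : ℝ≥0∞ :=
  ⨅ (Q : Measure (EuclideanSpace ℝ (Fin d))) (_ : IsProbOn 𝒳 Q) (_ : ∫ x, x ∂Q = y),
    InformationTheory.klDiv Q μ

/-- The primal objective `α g(Cx) + κ_μ(x)` with `g = ½ ‖b - ·‖²`. -/
def primalObjective (𝒳 : Set (EuclideanSpace ℝ (Fin d)))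
    (μ : Measure (EuclideanSpace ℝ (Fin d))) (C : Matrix (Fin m) (Fin d) ℝ)
    (b : EuclideanSpace ℝ (Fin m)) (α : ℝ) (x : EuclideanSpace ℝ (Fin d)) : ℝ≥0∞ :=
  ENNReal.ofReal (α * (1 / 2 * ‖b - mulVec C x‖ ^ 2)) + kappa 𝒳 μ x

/-- `x` solves the primal problem, i.e. it is a global minimizer of the primal objective. -/
def IsPrimalSolution (𝒳 : Set (EuclideanSpace ℝ (Fin d)))
    (μ : Measure (EuclideanSpace ℝ (Fin d))) (C : Matrix (Fin m) (Fin d) ℝ)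
    (b : EuclideanSpace ℝ (Fin m)) (α : ℝ) (x : EuclideanSpace ℝ (Fin d)) : Prop :=
  ∀ y, primalObjective 𝒳 μ C b α x ≤ primalObjective 𝒳 μ C b α y

/-- The dual objective `φ_ν(z) = ‖z‖² / (2α) - ⟨b, z⟩ + L_ν(Cᵀ z)`. -/
def dualObjective (ν : Measure (EuclideanSpace ℝ (Fin d))) (C : Matrix (Fin m) (Fin d) ℝ)
    (b : EuclideanSpace ℝ (Fin m)) (α : ℝ) (z : EuclideanSpace ℝ (Fin m)) : ℝ :=
  1 / (2 * α) * ‖z‖ ^ 2 - ⟪b, z⟫ + logMomentGen ν (mulVec C.transpose z)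

/-- The set of `ε`-minimizers of `φ_ν`: the points `z` with `φ_ν(z) ≤ inf φ_ν + ε`. -/
def epsMinimizers (ν : Measure (EuclideanSpace ℝ (Fin d))) (C : Matrix (Fin m) (Fin d) ℝ)
    (b : EuclideanSpace ℝ (Fin m)) (α ε : ℝ) : Set (EuclideanSpace ℝ (Fin m)) :=
  {z | ∀ w, dualObjective ν C b α z ≤ dualObjective ν C b α w + ε}

/-- The point `∇L_ν(Cᵀ z)` recovered from the dual point `z`. -/
def recover (ν : Measure (EuclideanSpace ℝ (Fin d))) (C : Matrix (Fin m) (Fin d) ℝ)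
    (z : EuclideanSpace ℝ (Fin m)) : EuclideanSpace ℝ (Fin d) :=
  gradient (logMomentGen ν) (mulVec C.transpose z)

/-- `X 0, X 1, …` are i.i.d. random vectors with values in `𝒳`. -/
structure IsSample {Ω : Type u} [MeasurableSpace Ω] (P : Measure Ω)
    (𝒳 : Set (EuclideanSpace ℝ (Fin d))) (X : ℕ → Ω → EuclideanSpace ℝ (Fin d)) : Prop where
  measurable : ∀ i, Measurable (X i)
  mem : ∀ i ω, X i ω ∈ 𝒳
  indep : iIndepFun X P
  identDistrib : ∀ i, IdentDistrib (X i) (X 0) P P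

/-- The empirical measure of the first `n` samples. -/
def empirical {Ω : Type u} (X : ℕ → Ω → EuclideanSpace ℝ (Fin d)) (n : ℕ) (ω : Ω) :
    Measure (EuclideanSpace ℝ (Fin d)) :=
  (n : ℝ≥0∞)⁻¹ • ∑ i ∈ Finset.range n, Measure.dirac (X i ω)

end

end MEM

namespace MEM

section Tilting

variable {d : ℕ} {ν : Measure (EuclideanSpace ℝ (Fin d))} {r : ℝ}

/-- The mean of the exponential tilting of `ν` in the direction `y`. -/
noncomputable def tiltedMean (ν : Measure (EuclideanSpace ℝ (Fin d)))
    (y : EuclideanSpace ℝ (Fin d)) : EuclideanSpace ℝ (Fin d) :=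
  ∫ x, x ∂(ν.tilted fun x => ⟪y, x⟫)

theorem integrable_id_of_ae_norm_le [IsFiniteMeasure ν] (hν : ∀ᵐ x ∂ν, ‖x‖ ≤ r) :
    Integrable (fun x => x) ν :=
  Integrable.of_bound aestronglyMeasurable_id r hν

theorem abs_inner_le_of_norm_le {y x : EuclideanSpace ℝ (Fin d)} (hx : ‖x‖ ≤ r) :
    |⟪y, x⟫| ≤ r * ‖y‖ :=
  (abs_real_inner_le_norm y x).trans <| by
    rw [mul_comm]; exact mul_le_mul_of_nonneg_right hx (norm_nonneg y)

theorem integrable_exp_inner [IsFiniteMeasure ν] (hν : ∀ᵐ x ∂ν, ‖x‖ ≤ r)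
    (y : EuclideanSpace ℝ (Fin d)) : Integrable (fun x => Real.exp ⟪y, x⟫) ν := by
  refine Integrable.of_bound (by fun_prop) (Real.exp (r * ‖y‖)) ?_
  filter_upwards [hν] with x hx
  rw [Real.norm_eq_abs, Real.abs_exp]
  exact Real.exp_le_exp.2 (le_of_abs_le (abs_inner_le_of_norm_le hx))

theorem integrable_exp_inner_smul [IsFiniteMeasure ν] (hν : ∀ᵐ x ∂ν, ‖x‖ ≤ r)
    (y : EuclideanSpace ℝ (Fin d)) : Integrable (fun x => Real.exp ⟪y, x⟫ • x) ν := by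
  refine Integrable.of_bound (by fun_prop) (Real.exp (r * ‖y‖) * r) ?_
  filter_upwards [hν] with x hx
  rw [norm_smul, Real.norm_eq_abs, Real.abs_exp]
  exact mul_le_mul (Real.exp_le_exp.2 (le_of_abs_le (abs_inner_le_of_norm_le hx))) hx
    (norm_nonneg _) (Real.exp_pos _).le

theorem isProbabilityMeasure_tilted_inner [IsProbabilityMeasure ν] (hν : ∀ᵐ x ∂ν, ‖x‖ ≤ r)
    (y : EuclideanSpace ℝ (Fin d)) : IsProbabilityMeasure (ν.tilted fun x => ⟪y, x⟫) :=
  isProbabilityMeasure_tilted (integrable_exp_inner hν y)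

theorem ae_norm_le_tilted (hν : ∀ᵐ x ∂ν, ‖x‖ ≤ r) (f : EuclideanSpace ℝ (Fin d) → ℝ) :
    ∀ᵐ x ∂(ν.tilted f), ‖x‖ ≤ r :=
  (tilted_absolutelyContinuous ν f).ae_le hν

theorem momentGen_pos [IsProbabilityMeasure ν] (hν : ∀ᵐ x ∂ν, ‖x‖ ≤ r)
    (y : EuclideanSpace ℝ (Fin d)) : 0 < momentGen ν y :=
  integral_exp_pos (integrable_exp_inner hν y)

theorem norm_integral_id_le [IsProbabilityMeasure ν] (hν : ∀ᵐ x ∂ν, ‖x‖ ≤ r) :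
    ‖∫ x, x ∂ν‖ ≤ r := by
  simpa using norm_integral_le_of_norm_le_const hν

theorem norm_tiltedMean_le [IsProbabilityMeasure ν] (hν : ∀ᵐ x ∂ν, ‖x‖ ≤ r)
    (y : EuclideanSpace ℝ (Fin d)) : ‖tiltedMean ν y‖ ≤ r :=
  have := isProbabilityMeasure_tilted_inner hν y
  norm_integral_id_le (ae_norm_le_tilted hν _)

theorem tiltedMean_eq (ν : Measure (EuclideanSpace ℝ (Fin d))) (y : EuclideanSpace ℝ (Fin d)) :
    tiltedMean ν y = (momentGen ν y)⁻¹ • ∫ x, Real.exp ⟪y, x⟫ • x ∂ν := by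
  rw [tiltedMean, integral_tilted, ← integral_smul]
  simp only [momentGen, div_eq_inv_mul, mul_smul]

theorem momentGen_add [IsProbabilityMeasure ν] (hν : ∀ᵐ x ∂ν, ‖x‖ ≤ r)
    (y v : EuclideanSpace ℝ (Fin d)) :
    momentGen ν (y + v) = momentGen ν y * momentGen (ν.tilted fun x => ⟪y, x⟫) v := by
  have h := integral_exp_tilted (μ := ν) (fun x => ⟪y, x⟫) (fun x => ⟪v, x⟫)
  have h0 := (momentGen_pos hν y).ne'
  simp only [momentGen] at h0 ⊢
  rw [h, mul_div_cancel₀ _ h0]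
  simp [inner_add_left]

theorem logMomentGen_add [IsProbabilityMeasure ν] (hν : ∀ᵐ x ∂ν, ‖x‖ ≤ r)
    (y v : EuclideanSpace ℝ (Fin d)) :
    logMomentGen ν (y + v) = logMomentGen ν y + logMomentGen (ν.tilted fun x => ⟪y, x⟫) v := by
  have := isProbabilityMeasure_tilted_inner hν y
  rw [logMomentGen, momentGen_add hν, Real.log_mul (momentGen_pos hν y).ne'
    (momentGen_pos (ae_norm_le_tilted hν _) v).ne']
  rfl

theorem tiltedMean_add [IsProbabilityMeasure ν] (hν : ∀ᵐ x ∂ν, ‖x‖ ≤ r)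
    (y v : EuclideanSpace ℝ (Fin d)) :
    tiltedMean ν (y + v) = tiltedMean (ν.tilted fun x => ⟪y, x⟫) v := by
  rw [tiltedMean, tiltedMean, tilted_tilted (integrable_exp_inner hν y)]
  congr 2
  ext x
  simp [inner_add_left]

theorem inner_integral_id_le_logMomentGen [IsProbabilityMeasure ν] (hν : ∀ᵐ x ∂ν, ‖x‖ ≤ r)
    (v : EuclideanSpace ℝ (Fin d)) : ⟪∫ x, x ∂ν, v⟫ ≤ logMomentGen ν v := by
  set a := ⟪∫ x, x ∂ν, v⟫ with ha
  have hid := integrable_id_of_ae_norm_le hν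
  have hint : Integrable (fun x => ⟪v, x⟫) ν := hid.const_inner v
  have ha' : ∫ x, ⟪v, x⟫ ∂ν = a := by
    rw [integral_inner hid, ha, real_inner_comm]
  rw [logMomentGen, Real.le_log_iff_exp_le (momentGen_pos hν v)]
  calc Real.exp a = ∫ x, Real.exp a * (⟪v, x⟫ - a + 1) ∂ν := by
        rw [integral_const_mul, integral_add (by fun_prop) (by fun_prop),
          integral_sub hint (by fun_prop), ha']
        simp
    _ ≤ momentGen ν v := by
        refine integral_mono (by fun_prop) (integrable_exp_inner hν v) fun x => ?_
        calc Real.exp a * (⟪v, x⟫ - a + 1) ≤ Real.exp a * Real.exp (⟪v, x⟫ - a) :=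
              mul_le_mul_of_nonneg_left (Real.add_one_le_exp _) (Real.exp_pos _).le
          _ = Real.exp ⟪v, x⟫ := by rw [← Real.exp_add]; ring_nf

theorem neg_mul_norm_le_logMomentGen [IsProbabilityMeasure ν] (hν : ∀ᵐ x ∂ν, ‖x‖ ≤ r)
    (v : EuclideanSpace ℝ (Fin d)) : -(r * ‖v‖) ≤ logMomentGen ν v := by
  refine le_trans (neg_le_of_abs_le ?_) (inner_integral_id_le_logMomentGen hν v)
  rw [real_inner_comm]
  exact abs_inner_le_of_norm_le (norm_integral_id_le hν)

theorem logMomentGen_add_inner_le [IsProbabilityMeasure ν] (hν : ∀ᵐ x ∂ν, ‖x‖ ≤ r)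
    (y w : EuclideanSpace ℝ (Fin d)) :
    logMomentGen ν y + ⟪tiltedMean ν y, w - y⟫ ≤ logMomentGen ν w := by
  have := isProbabilityMeasure_tilted_inner hν y
  have h := logMomentGen_add hν y (w - y)
  rw [add_sub_cancel] at h
  rw [h]
  exact add_le_add_right (inner_integral_id_le_logMomentGen (ae_norm_le_tilted hν _) _) _

theorem inner_tiltedMean_sub_nonneg [IsProbabilityMeasure ν] (hν : ∀ᵐ x ∂ν, ‖x‖ ≤ r)
    (y w : EuclideanSpace ℝ (Fin d)) : 0 ≤ ⟪tiltedMean ν w - tiltedMean ν y, w - y⟫ := by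
  have h1 := logMomentGen_add_inner_le hν y w
  have h2 := logMomentGen_add_inner_le hν w y
  rw [← neg_sub w y, inner_neg_right] at h2
  rw [inner_sub_left]
  linarith

theorem norm_tiltedMean_sub_integral_le [IsProbabilityMeasure ν] (hr : 0 ≤ r)
    (hν : ∀ᵐ x ∂ν, ‖x‖ ≤ r) (v : EuclideanSpace ℝ (Fin d)) :
    ‖tiltedMean ν v - ∫ x, x ∂ν‖ ≤ 4 * r ^ 2 * ‖v‖ := by
  have hid := integrable_id_of_ae_norm_le hν
  rcases le_total 1 (2 * (r * ‖v‖)) with h | h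
  · calc ‖tiltedMean ν v - ∫ x, x ∂ν‖ ≤ r + r :=
          (norm_sub_le _ _).trans (add_le_add (norm_tiltedMean_le hν v) (norm_integral_id_le hν))
      _ ≤ 4 * r ^ 2 * ‖v‖ := by nlinarith
  · set R := r * ‖v‖ with hR
    have hR0 : 0 ≤ R := by positivity
    set Z := momentGen ν v with hZ
    have hZpos : 0 < Z := momentGen_pos hν v
    have hexp : ∀ᵐ x ∂ν, Real.exp (-R) ≤ Real.exp ⟪v, x⟫ ∧ Real.exp ⟪v, x⟫ ≤ Real.exp R := by
      filter_upwards [hν] with x hx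
      have := abs_le.1 (abs_inner_le_of_norm_le (y := v) hx)
      exact ⟨Real.exp_le_exp.2 this.1, Real.exp_le_exp.2 this.2⟩
    have hint := integrable_exp_inner hν v
    have hZl : Real.exp (-R) ≤ Z := by
      simpa [hZ, momentGen] using
        integral_mono_ae (integrable_const _) hint (hexp.mono fun x hx => hx.1)
    have hZu : Z ≤ Real.exp R := by
      simpa [hZ, momentGen] using
        integral_mono_ae hint (integrable_const _) (hexp.mono fun x hx => hx.2)
    have hsub : tiltedMean ν v - ∫ x, x ∂ν = ∫ x, (Z⁻¹ * Real.exp ⟪v, x⟫ - 1) • x ∂ν := by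
      have hs : Integrable (fun x => Z⁻¹ • Real.exp ⟪v, x⟫ • x) ν :=
        (integrable_exp_inner_smul hν v).fun_smul _
      rw [tiltedMean_eq, ← integral_smul, ← integral_sub hs hid]
      simp only [sub_smul, mul_smul, one_smul, hZ]
    have hb : ∀ᵐ x ∂ν, ‖(Z⁻¹ * Real.exp ⟪v, x⟫ - 1) • x‖ ≤ 4 * R * r := by
      filter_upwards [hν, hexp] with x hx hxe
      rw [norm_smul]
      refine mul_le_mul ?_ hx (norm_nonneg _) (by positivity)
      have hq : Z⁻¹ * Real.exp ⟪v, x⟫ = Real.exp ⟪v, x⟫ / Z := by ring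
      have hu : Real.exp ⟪v, x⟫ / Z ≤ Real.exp (2 * R) := by
        rw [div_le_iff₀ hZpos]
        calc Real.exp ⟪v, x⟫ ≤ Real.exp R := hxe.2
          _ = Real.exp (2 * R) * Real.exp (-R) := by rw [← Real.exp_add]; ring_nf
          _ ≤ _ := mul_le_mul_of_nonneg_left hZl (Real.exp_pos _).le
      have hl : Real.exp (-(2 * R)) ≤ Real.exp ⟪v, x⟫ / Z := by
        rw [le_div_iff₀ hZpos]
        calc Real.exp (-(2 * R)) * Z ≤ Real.exp (-(2 * R)) * Real.exp R :=
              mul_le_mul_of_nonneg_left hZu (Real.exp_pos _).le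
          _ = Real.exp (-R) := by rw [← Real.exp_add]; ring_nf
          _ ≤ _ := hxe.1
      have h1 := Real.abs_exp_sub_one_le (x := 2 * R) (by rwa [abs_of_nonneg (by positivity)])
      rw [abs_of_nonneg (a := 2 * R) (by positivity)] at h1
      have h2 := Real.add_one_le_exp (-(2 * R))
      rw [hq, Real.norm_eq_abs, abs_le]
      constructor
      · linarith
      · linarith [le_of_abs_le h1]
    rw [hsub]
    calc _ ≤ 4 * R * r := by simpa using norm_integral_le_of_norm_le_const hb
      _ = _ := by rw [hR]; ring

theorem norm_tiltedMean_sub_le [IsProbabilityMeasure ν] (hr : 0 ≤ r) (hν : ∀ᵐ x ∂ν, ‖x‖ ≤ r)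
    (y w : EuclideanSpace ℝ (Fin d)) :
    ‖tiltedMean ν w - tiltedMean ν y‖ ≤ 4 * r ^ 2 * ‖w - y‖ := by
  have := isProbabilityMeasure_tilted_inner hν y
  have h := norm_tiltedMean_sub_integral_le hr (ae_norm_le_tilted hν fun x => ⟪y, x⟫) (w - y)
  rwa [← tiltedMean_add hν, add_sub_cancel] at h

theorem hasGradientAt_logMomentGen [IsProbabilityMeasure ν] (hν : ∀ᵐ x ∂ν, ‖x‖ ≤ r)
    (y : EuclideanSpace ℝ (Fin d)) : HasGradientAt (logMomentGen ν) (tiltedMean ν y) y := by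
  have hF : HasFDerivAt (momentGen ν) (∫ x, Real.exp ⟪y, x⟫ • innerSL ℝ x ∂ν) y := by
    refine hasFDerivAt_integral_of_dominated_of_fderiv_le (s := Metric.ball y 1)
      (F' := fun w x => Real.exp ⟪w, x⟫ • innerSL ℝ x)
      (bound := fun x => Real.exp (r * (‖y‖ + 1)) * r) (Metric.ball_mem_nhds y one_pos)
      (Filter.Eventually.of_forall fun w => by fun_prop) (integrable_exp_inner hν y)
      (by fun_prop) ?_ (integrable_const _) ?_
    · filter_upwards [hν] with x hx w hw
      have hr : 0 ≤ r := (norm_nonneg x).trans hx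
      rw [norm_smul, Real.norm_eq_abs, Real.abs_exp, innerSL_apply_norm]
      refine mul_le_mul (Real.exp_le_exp.2 ?_) hx (norm_nonneg _) (Real.exp_pos _).le
      refine (le_of_abs_le (abs_inner_le_of_norm_le hx)).trans (mul_le_mul_of_nonneg_left ?_ hr)
      have h1 : ‖w - y‖ < 1 := by simpa [dist_eq_norm] using hw
      linarith [norm_sub_norm_le w y]
    · refine Filter.Eventually.of_forall fun x w _ => ?_
      have h : HasFDerivAt (fun w : EuclideanSpace ℝ (Fin d) => ⟪w, x⟫) (innerSL ℝ x) w := by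
        have := (innerSL ℝ x).hasFDerivAt (x := w)
        refine this.congr_of_eventuallyEq (Filter.Eventually.of_forall fun w => ?_)
        simp [real_inner_comm]
      exact h.exp
  have hL := hF.log (momentGen_pos hν y).ne'
  have hi : Integrable (fun x => Real.exp ⟪y, x⟫ • innerSL ℝ x) ν := by
    have := (innerSL ℝ (E := EuclideanSpace ℝ (Fin d))).integrable_comp
      (integrable_exp_inner_smul hν y)
    simpa using this
  have hd : InnerProductSpace.toDual ℝ _ (tiltedMean ν y) =
      (momentGen ν y)⁻¹ • ∫ x, Real.exp ⟪y, x⟫ • innerSL ℝ x ∂ν := by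
    ext1 w
    rw [tiltedMean_eq, _root_.smul_apply, ContinuousLinearMap.integral_apply hi,
      InnerProductSpace.toDual_apply_apply, real_inner_smul_left, real_inner_comm,
      ← integral_inner (integrable_exp_inner_smul hν y)]
    simp [real_inner_smul_right, real_inner_comm]
  rw [hasGradientAt_iff_hasFDerivAt, hd]
  exact hL

end Tilting

section Linear

variable {d m : ℕ} (C : Matrix (Fin m) (Fin d) ℝ)

theorem inner_mulVec_left (x : EuclideanSpace ℝ (Fin d)) (z : EuclideanSpace ℝ (Fin m)) :
    ⟪mulVec C x, z⟫ = ⟪x, mulVec C.transpose z⟫ := by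
  rw [mulVec, mulVec, ← Matrix.conjTranspose_eq_transpose_of_trivial,
    Matrix.toEuclideanLin_conjTranspose_eq_adjoint, LinearMap.adjoint_inner_right]

theorem mulVec_sub (x y : EuclideanSpace ℝ (Fin d)) :
    mulVec C (x - y) = mulVec C x - mulVec C y :=
  map_sub _ x y

theorem norm_mulVec_le (x : EuclideanSpace ℝ (Fin d)) : ‖mulVec C x‖ ≤ specNorm C * ‖x‖ :=
  (Matrix.toEuclideanLin C).toContinuousLinearMap.le_opNorm x

theorem specNorm_nonneg : 0 ≤ specNorm C := norm_nonneg _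

theorem norm_mulVec_transpose_le (z : EuclideanSpace ℝ (Fin m)) :
    ‖mulVec C.transpose z‖ ≤ specNorm C * ‖z‖ := by
  set u := mulVec C.transpose z with hu
  rcases (norm_nonneg u).eq_or_lt with h | h
  · rw [← h]; exact mul_nonneg (specNorm_nonneg C) (norm_nonneg z)
  · refine le_of_mul_le_mul_left ?_ h
    calc ‖u‖ * ‖u‖ = ⟪mulVec C u, z⟫ := by
          rw [inner_mulVec_left, ← hu, real_inner_self_eq_norm_mul_norm]
      _ ≤ ‖mulVec C u‖ * ‖z‖ := real_inner_le_norm _ _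
      _ ≤ specNorm C * ‖u‖ * ‖z‖ :=
          mul_le_mul_of_nonneg_right (norm_mulVec_le C u) (norm_nonneg z)
      _ = ‖u‖ * (specNorm C * ‖z‖) := by ring

theorem hasFDerivAt_mulVec (x : EuclideanSpace ℝ (Fin d)) :
    HasFDerivAt (mulVec C) (Matrix.toEuclideanLin C).toContinuousLinearMap x :=
  (Matrix.toEuclideanLin C).toContinuousLinearMap.hasFDerivAt

theorem continuous_mulVec : Continuous (mulVec C) :=
  (Matrix.toEuclideanLin C).toContinuousLinearMap.continuous

theorem sigmaMin_nonneg : 0 ≤ sigmaMin C := Real.sqrt_nonneg _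

theorem sigmaMin_sq_le (i : Fin d) :
    sigmaMin C ^ 2 ≤ (Matrix.isHermitian_conjTranspose_mul_self C).eigenvalues i := by
  rw [sigmaMin, Real.sq_sqrt (Real.iInf_nonneg fun i =>
    Matrix.eigenvalues_conjTranspose_mul_self_nonneg C i)]
  exact ciInf_le (Set.finite_range _).bddBelow i

theorem sigmaMin_pos [NeZero d] (hC : C.rank = d) : 0 < sigmaMin C := by
  set hA := Matrix.isHermitian_conjTranspose_mul_self C with hAdef
  have hne : ∀ i, hA.eigenvalues i ≠ 0 := by
    have h := hA.rank_eq_card_non_zero_eigs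
    rw [Matrix.rank_conjTranspose_mul_self, hC] at h
    by_contra! hcon
    obtain ⟨i, hi⟩ := hcon
    have := Fintype.card_subtype_lt (p := fun i => hA.eigenvalues i ≠ 0) (x := i) (by simpa using hi)
    rw [Fintype.card_fin] at this
    omega
  obtain ⟨i, hi⟩ := exists_eq_ciInf_of_finite (f := hA.eigenvalues)
  rw [sigmaMin, Real.sqrt_pos, ← hi]
  exact (Matrix.eigenvalues_conjTranspose_mul_self_nonneg C i).lt_of_ne' (hne i)

theorem sigmaMin_mul_norm_le (x : EuclideanSpace ℝ (Fin d)) :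
    sigmaMin C * ‖x‖ ≤ ‖mulVec C x‖ := by
  refine le_of_sq_le_sq ?_ (norm_nonneg _)
  set hA := Matrix.isHermitian_conjTranspose_mul_self C with hAdef
  set v := hA.eigenvectorBasis with hv
  have hev : ∀ i, mulVec C.transpose (mulVec C (v i)) = hA.eigenvalues i • v i := by
    intro i
    have h := hA.mulVec_eigenvectorBasis i
    ext j
    have hj := congrFun h j
    rw [← Matrix.mulVec_mulVec] at hj
    simpa [hv, mulVec, Matrix.conjTranspose_eq_transpose_of_trivial] using hj
  have hC2 : ‖mulVec C x‖ ^ 2 = ∑ i, hA.eigenvalues i * ⟪v i, x⟫ ^ 2 := by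
    rw [← real_inner_self_eq_norm_sq, inner_mulVec_left, ← v.sum_inner_mul_inner]
    refine Finset.sum_congr rfl fun i _ => ?_
    rw [← inner_mulVec_left, real_inner_comm (mulVec C x), inner_mulVec_left, hev,
      real_inner_smul_right, real_inner_comm x (v i)]
    ring
  rw [mul_pow, hC2, ← v.sum_sq_inner_right x, Finset.mul_sum]
  exact Finset.sum_le_sum fun i _ =>
    mul_le_mul_of_nonneg_right (sigmaMin_sq_le C i) (sq_nonneg _)

theorem norm_le_div_sigmaMin (hC : C.rank = d) (x : EuclideanSpace ℝ (Fin d)) :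
    ‖x‖ ≤ ‖mulVec C x‖ / sigmaMin C := by
  rcases Nat.eq_zero_or_pos d with rfl | hd
  · rw [Subsingleton.elim x 0, norm_zero]
    exact div_nonneg (norm_nonneg _) (sigmaMin_nonneg C)
  · have : NeZero d := ⟨hd.ne'⟩
    rw [le_div_iff₀ (sigmaMin_pos C hC), mul_comm]
    exact sigmaMin_mul_norm_le C x

end Linear

section Dual

variable {d m : ℕ} {ν : Measure (EuclideanSpace ℝ (Fin d))} {r α : ℝ}
  {C : Matrix (Fin m) (Fin d) ℝ} {b : EuclideanSpace ℝ (Fin m)}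

theorem recover_eq_tiltedMean [IsProbabilityMeasure ν] (hν : ∀ᵐ x ∂ν, ‖x‖ ≤ r)
    (z : EuclideanSpace ℝ (Fin m)) : recover ν C z = tiltedMean ν (mulVec C.transpose z) :=
  (hasGradientAt_logMomentGen hν _).gradient

/-- The first-order optimality condition of the dual problem. -/
def IsDualCritical (ν : Measure (EuclideanSpace ℝ (Fin d))) (C : Matrix (Fin m) (Fin d) ℝ)
    (b : EuclideanSpace ℝ (Fin m)) (α : ℝ) (z : EuclideanSpace ℝ (Fin m)) : Prop :=
  z = α • (b - mulVec C (tiltedMean ν (mulVec C.transpose z)))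

theorem tendsto_dualObjective [IsProbabilityMeasure ν] (hr : 0 ≤ r) (hν : ∀ᵐ x ∂ν, ‖x‖ ≤ r)
    (hα : 0 < α) :
    Filter.Tendsto (dualObjective ν C b α) (Filter.cocompact _) Filter.atTop := by
  have h1 : Filter.Tendsto (fun t : ℝ => t * (1 / (2 * α) * t + -(‖b‖ + r * specNorm C)))
      Filter.atTop Filter.atTop :=
    Filter.tendsto_id.atTop_mul_atTop₀ <| Filter.tendsto_atTop_add_const_right _ _ <|
      Filter.tendsto_id.const_mul_atTop (by positivity)
  refine Filter.tendsto_atTop_mono (fun z => ?_)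
    (h1.comp (tendsto_norm_cocompact_atTop (E := EuclideanSpace ℝ (Fin m))))
  have h2 := neg_mul_norm_le_logMomentGen hν (mulVec C.transpose z)
  have h3 := mul_le_mul_of_nonneg_left (norm_mulVec_transpose_le C z) hr
  have h4 := real_inner_le_norm b z
  simp only [Function.comp, dualObjective]
  nlinarith

theorem hasFDerivAt_dualObjective [IsProbabilityMeasure ν] (hν : ∀ᵐ x ∂ν, ‖x‖ ≤ r)
    (z : EuclideanSpace ℝ (Fin m)) :
    HasFDerivAt (dualObjective ν C b α)
      ((1 / (2 * α)) • (2 • innerSL ℝ z) - innerSL ℝ b +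
        (InnerProductSpace.toDual ℝ _ (tiltedMean ν (mulVec C.transpose z))).comp
          (Matrix.toEuclideanLin C.transpose).toContinuousLinearMap) z := by
  have h1 := ((hasStrictFDerivAt_norm_sq z).hasFDerivAt.const_mul (1 / (2 * α)))
  have h2 := (innerSL ℝ b).hasFDerivAt (x := z)
  have h3 := (hasGradientAt_logMomentGen hν (mulVec C.transpose z)).hasFDerivAt.comp z
    (hasFDerivAt_mulVec C.transpose z)
  exact (h1.sub h2).add h3

theorem exists_isDualCritical [IsProbabilityMeasure ν] (hr : 0 ≤ r) (hν : ∀ᵐ x ∂ν, ‖x‖ ≤ r)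
    (hα : 0 < α) : ∃ z, IsDualCritical ν C b α z := by
  have hcont : Continuous (dualObjective ν C b α) :=
    continuous_iff_continuousAt.2 fun z => (hasFDerivAt_dualObjective hν z).continuousAt
  obtain ⟨z, hz⟩ := hcont.exists_forall_le (tendsto_dualObjective hr hν hα)
  refine ⟨z, ?_⟩
  have h0 := IsLocalMin.hasFDerivAt_eq_zero (Filter.Eventually.of_forall hz)
    (hasFDerivAt_dualObjective hν z)
  set G := tiltedMean ν (mulVec C.transpose z) with hG
  have h : α⁻¹ • z - b + mulVec C G = 0 := by
    refine ext_inner_right ℝ fun w => ?_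
    have hw := DFunLike.congr_fun h0 w
    have : ⟪mulVec C G, w⟫ = ⟪G, Matrix.toEuclideanLin C.transpose w⟫ := inner_mulVec_left C G w
    rw [inner_add_left, inner_sub_left, real_inner_smul_left, this, inner_zero_left]
    simp at hw
    rw [← hw]
    ring
  rw [IsDualCritical, ← hG]
  have h' : b - mulVec C G = α⁻¹ • z := by
    rw [← sub_eq_zero, ← neg_eq_zero, ← h]; abel
  rw [h', smul_inv_smul₀ hα.ne']

theorem IsDualCritical.norm_le [IsProbabilityMeasure ν] (hν : ∀ᵐ x ∂ν, ‖x‖ ≤ r)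
    (hα : 0 < α) {z : EuclideanSpace ℝ (Fin m)} (hz : IsDualCritical ν C b α z) :
    ‖z‖ ≤ α * (‖b‖ + specNorm C * r) := by
  rw [hz, norm_smul, Real.norm_of_nonneg hα.le]
  refine mul_le_mul_of_nonneg_left ((norm_sub_le _ _).trans (add_le_add_right ?_ _)) hα.le
  exact (norm_mulVec_le C _).trans
    (mul_le_mul_of_nonneg_left (norm_tiltedMean_le hν _) (specNorm_nonneg C))

theorem IsDualCritical.add_norm_sq_le [IsProbabilityMeasure ν] (hν : ∀ᵐ x ∂ν, ‖x‖ ≤ r)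
    (hα : 0 < α) {z : EuclideanSpace ℝ (Fin m)} (hz : IsDualCritical ν C b α z)
    (w : EuclideanSpace ℝ (Fin m)) :
    dualObjective ν C b α z + 1 / (2 * α) * ‖w - z‖ ^ 2 ≤ dualObjective ν C b α w := by
  set G := tiltedMean ν (mulVec C.transpose z) with hG
  have h1 := logMomentGen_add_inner_le hν (mulVec C.transpose z) (mulVec C.transpose w)
  rw [← mulVec_sub, ← inner_mulVec_left, ← hG] at h1
  have h2 : ‖w‖ ^ 2 = ‖z‖ ^ 2 + 2 * ⟪z, w - z⟫ + ‖w - z‖ ^ 2 := by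
    rw [← norm_add_sq_real, add_sub_cancel]
  have h3 : ⟪z, w - z⟫ = α * (⟪b, w - z⟫ - ⟪mulVec C G, w - z⟫) := by
    rw [← inner_sub_left, ← real_inner_smul_left]
    exact congrArg (⟪·, w - z⟫) hz
  have h4 : 1 / (2 * α) * ‖w‖ ^ 2 = 1 / (2 * α) * ‖z‖ ^ 2 +
      (⟪b, w - z⟫ - ⟪mulVec C G, w - z⟫) + 1 / (2 * α) * ‖w - z‖ ^ 2 := by
    rw [h2, h3]; field_simp
  have h5 : ⟪b, w - z⟫ = ⟪b, w⟫ - ⟪b, z⟫ := inner_sub_right _ _ _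
  simp only [dualObjective]
  linarith

theorem IsDualCritical.norm_sub_le_sqrt [IsProbabilityMeasure ν] (hν : ∀ᵐ x ∂ν, ‖x‖ ≤ r)
    (hα : 0 < α) {z w : EuclideanSpace ℝ (Fin m)} {ε : ℝ} (hz : IsDualCritical ν C b α z)
    (hw : w ∈ epsMinimizers ν C b α ε) : ‖w - z‖ ≤ √(2 * α) * √ε := by
  rw [← Real.sqrt_mul (by positivity)]
  refine Real.le_sqrt_of_sq_le ?_
  have h : 1 / (2 * α) * ‖w - z‖ ^ 2 ≤ ε := by linarith [hz.add_norm_sq_le hν hα w, hw z]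
  rwa [one_div, inv_mul_le_iff₀ (by positivity)] at h

theorem norm_tiltedMean_sub_le_of_isDualCritical {μ : Measure (EuclideanSpace ℝ (Fin d))}
    [IsProbabilityMeasure ν] (hν : ∀ᵐ x ∂ν, ‖x‖ ≤ r) (hα : 0 < α) (hC : C.rank = d)
    {z w : EuclideanSpace ℝ (Fin m)} (hz : IsDualCritical μ C b α z)
    (hw : IsDualCritical ν C b α w) :
    ‖tiltedMean ν (mulVec C.transpose w) - tiltedMean μ (mulVec C.transpose z)‖ ≤
      specNorm C / sigmaMin C *
        ‖tiltedMean ν (mulVec C.transpose z) - tiltedMean μ (mulVec C.transpose z)‖ := by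
  set G := tiltedMean ν (mulVec C.transpose w) with hG
  set H := tiltedMean ν (mulVec C.transpose z) with hH
  set F := tiltedMean μ (mulVec C.transpose z) with hF
  have h1 : w - z = -(α • mulVec C (G - F)) := by
    rw [mulVec_sub]
    conv_lhs => rw [hz, hw, ← hG, ← hF]
    module
  have h2 : 0 ≤ ⟪mulVec C (G - H), w - z⟫ := by
    rw [inner_mulVec_left, mulVec_sub]
    exact inner_tiltedMean_sub_nonneg hν _ _
  have h3 : ⟪mulVec C (G - H), mulVec C (G - F)⟫ ≤ 0 := by
    rw [h1, inner_neg_right, real_inner_smul_right] at h2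
    by_contra! hcon
    linarith [mul_pos hα hcon]
  have h4 : ‖mulVec C (G - F)‖ ≤ specNorm C * ‖H - F‖ := by
    refine le_trans ?_ (norm_mulVec_le C _)
    rcases (norm_nonneg (mulVec C (G - F))).eq_or_lt with h | h
    · rw [← h]; exact norm_nonneg _
    refine le_of_mul_le_mul_right ?_ h
    have h5 : mulVec C (G - F) = mulVec C (G - H) + mulVec C (H - F) := by
      simp only [mulVec_sub]; abel
    calc ‖mulVec C (G - F)‖ * ‖mulVec C (G - F)‖ =
          ⟪mulVec C (G - H), mulVec C (G - F)⟫ + ⟪mulVec C (H - F), mulVec C (G - F)⟫ := by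
          rw [← real_inner_self_eq_norm_mul_norm, ← inner_add_left, ← h5]
      _ ≤ 0 + ‖mulVec C (H - F)‖ * ‖mulVec C (G - F)‖ := add_le_add h3 (real_inner_le_norm _ _)
      _ = _ := zero_add _
  calc ‖G - F‖ ≤ ‖mulVec C (G - F)‖ / sigmaMin C := norm_le_div_sigmaMin C hC _
    _ ≤ specNorm C * ‖H - F‖ / sigmaMin C := div_le_div_of_nonneg_right h4 (sigmaMin_nonneg C)
    _ = _ := by ring

end Dual

section Primal

variable {d m : ℕ} {μ : Measure (EuclideanSpace ℝ (Fin d))} {r α : ℝ}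
  {𝒳 : Set (EuclideanSpace ℝ (Fin d))}
  {C : Matrix (Fin m) (Fin d) ℝ} {b : EuclideanSpace ℝ (Fin m)}

theorem IsProbOn.ae_norm_le (h𝒳 : ∀ x ∈ 𝒳, ‖x‖ ≤ r) {Q : Measure (EuclideanSpace ℝ (Fin d))}
    (hQ : IsProbOn 𝒳 Q) : ∀ᵐ x ∂Q, ‖x‖ ≤ r := by
  have h : ∀ᵐ x ∂Q, x ∈ 𝒳 := mem_ae_iff.2 hQ.2
  exact h.mono h𝒳

theorem IsProbOn.tilted_inner (h𝒳 : ∀ x ∈ 𝒳, ‖x‖ ≤ r) (hμ : IsProbOn 𝒳 μ)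
    (y : EuclideanSpace ℝ (Fin d)) : IsProbOn 𝒳 (μ.tilted fun x => ⟪y, x⟫) := by
  have := hμ.1
  exact ⟨isProbabilityMeasure_tilted_inner (hμ.ae_norm_le h𝒳) y,
    tilted_absolutelyContinuous μ _ hμ.2⟩

/-- The easy half of the Donsker-Varadhan formula. -/
theorem ofReal_inner_sub_logMomentGen_le_klDiv [IsProbabilityMeasure μ]
    (hμ : ∀ᵐ x ∂μ, ‖x‖ ≤ r) {Q : Measure (EuclideanSpace ℝ (Fin d))} [IsProbabilityMeasure Q]
    (hQ : ∀ᵐ x ∂Q, ‖x‖ ≤ r) (y : EuclideanSpace ℝ (Fin d)) :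
    ENNReal.ofReal (⟪y, ∫ x, x ∂Q⟫ - logMomentGen μ y) ≤ InformationTheory.klDiv Q μ := by
  by_cases hkl : InformationTheory.klDiv Q μ = ∞
  · rw [hkl]; exact le_top
  obtain ⟨hac, hllr⟩ := InformationTheory.klDiv_ne_top_iff.1 hkl
  refine ENNReal.ofReal_le_of_le_toReal ?_
  have hid := integrable_id_of_ae_norm_le hQ
  have hexp := integrable_exp_inner hμ y
  have := isProbabilityMeasure_tilted_inner hμ y
  have h := integral_llr_tilted_right hac (hid.const_inner (𝕜 := ℝ) y) hexp hllr
  have h0 : 0 ≤ ∫ x, llr Q (μ.tilted fun x => ⟪y, x⟫) x ∂Q := by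
    rw [← InformationTheory.toReal_klDiv_of_measure_eq
      (hac.trans (absolutelyContinuous_tilted hexp)) (by simp)]
    exact ENNReal.toReal_nonneg
  rw [InformationTheory.toReal_klDiv_of_measure_eq hac (by simp), ← integral_inner hid]
  rw [h] at h0
  simp only [logMomentGen, momentGen]
  linarith

theorem klDiv_tilted_inner [IsProbabilityMeasure μ] (hμ : ∀ᵐ x ∂μ, ‖x‖ ≤ r)
    (y : EuclideanSpace ℝ (Fin d)) :
    0 ≤ ⟪y, tiltedMean μ y⟫ - logMomentGen μ y ∧
      InformationTheory.klDiv (μ.tilted fun x => ⟪y, x⟫) μ =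
        ENNReal.ofReal (⟪y, tiltedMean μ y⟫ - logMomentGen μ y) := by
  have hexp := integrable_exp_inner hμ y
  have hprob := isProbabilityMeasure_tilted_inner hμ y
  have hac := tilted_absolutelyContinuous μ fun x => ⟪y, x⟫
  have hid := integrable_id_of_ae_norm_le (ae_norm_le_tilted hμ fun x => ⟪y, x⟫)
  have hint := hid.const_inner (𝕜 := ℝ) y
  have hllr : llr (μ.tilted fun x => ⟪y, x⟫) μ =ᵐ[μ.tilted fun x => ⟪y, x⟫]
      fun x => ⟪y, x⟫ - logMomentGen μ y :=
    hac.ae_le (log_rnDeriv_tilted_left_self hexp)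
  have hi : Integrable (llr (μ.tilted fun x => ⟪y, x⟫) μ) (μ.tilted fun x => ⟪y, x⟫) :=
    (integrable_congr hllr).2 (hint.sub (integrable_const _))
  have hval : (InformationTheory.klDiv (μ.tilted fun x => ⟪y, x⟫) μ).toReal =
      ⟪y, tiltedMean μ y⟫ - logMomentGen μ y := by
    rw [InformationTheory.toReal_klDiv_of_measure_eq hac (by simp), integral_congr_ae hllr,
      integral_sub hint (integrable_const _), integral_inner hid]
    simp [tiltedMean]
  rw [← hval]
  exact ⟨ENNReal.toReal_nonneg,
    (ENNReal.ofReal_toReal (InformationTheory.klDiv_ne_top hac hi)).symm⟩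

theorem ofReal_le_primalObjective (h𝒳 : ∀ x ∈ 𝒳, ‖x‖ ≤ r) (hμ : IsProbOn 𝒳 μ)
    (x y : EuclideanSpace ℝ (Fin d)) :
    ENNReal.ofReal (α * (1 / 2 * ‖b - mulVec C x‖ ^ 2) + (⟪y, x⟫ - logMomentGen μ y)) ≤
      primalObjective 𝒳 μ C b α x := by
  have := hμ.1
  refine ENNReal.ofReal_add_le.trans (add_le_add_right ?_ _)
  refine le_iInf fun Q => le_iInf fun hQ => le_iInf fun hx => ?_
  have := hQ.1
  rw [← hx]
  exact ofReal_inner_sub_logMomentGen_le_klDiv (hμ.ae_norm_le h𝒳) (hQ.ae_norm_le h𝒳) y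

theorem primalObjective_tiltedMean_le (h𝒳 : ∀ x ∈ 𝒳, ‖x‖ ≤ r) (hμ : IsProbOn 𝒳 μ) (hα : 0 < α)
    (y : EuclideanSpace ℝ (Fin d)) :
    primalObjective 𝒳 μ C b α (tiltedMean μ y) ≤
      ENNReal.ofReal (α * (1 / 2 * ‖b - mulVec C (tiltedMean μ y)‖ ^ 2) +
        (⟪y, tiltedMean μ y⟫ - logMomentGen μ y)) := by
  have := hμ.1
  obtain ⟨h0, h1⟩ := klDiv_tilted_inner (hμ.ae_norm_le h𝒳) y
  rw [ENNReal.ofReal_add (by positivity) h0, ← h1]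
  refine add_le_add_right ?_ _
  refine iInf_le_of_le (μ.tilted fun x => ⟪y, x⟫) ?_
  refine iInf_le_of_le (hμ.tilted_inner h𝒳 y) ?_
  exact iInf_le_of_le rfl le_rfl

theorem IsDualCritical.isPrimalSolution_iff (h𝒳 : ∀ x ∈ 𝒳, ‖x‖ ≤ r) (hμ : IsProbOn 𝒳 μ)
    (hα : 0 < α) (hC : C.rank = d) {z : EuclideanSpace ℝ (Fin m)}
    (hz : IsDualCritical μ C b α z) (x : EuclideanSpace ℝ (Fin d)) :
    IsPrimalSolution 𝒳 μ C b α x ↔ x = tiltedMean μ (mulVec C.transpose z) := by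
  have := hμ.1
  set y := mulVec C.transpose z with hy
  set G := tiltedMean μ y with hG
  set V := α * (1 / 2 * ‖b - mulVec C G‖ ^ 2) + (⟪y, G⟫ - logMomentGen μ y) with hV
  have hV0 : 0 ≤ V := add_nonneg (by positivity) (klDiv_tilted_inner (hμ.ae_norm_le h𝒳) y).1
  have hle : primalObjective 𝒳 μ C b α G ≤ ENNReal.ofReal V :=
    primalObjective_tiltedMean_le h𝒳 hμ hα y
  have hge : ∀ w, ENNReal.ofReal (V + α / 2 * ‖mulVec C (w - G)‖ ^ 2) ≤
      primalObjective 𝒳 μ C b α w := by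
    intro w
    refine le_of_eq_of_le (congrArg _ ?_) (ofReal_le_primalObjective h𝒳 hμ w y)
    have h1 : b - mulVec C w = (b - mulVec C G) - mulVec C (w - G) := by
      rw [mulVec_sub]; abel
    have h2 : ⟪y, w⟫ - ⟪y, G⟫ = α * ⟪b - mulVec C G, mulVec C (w - G)⟫ := by
      rw [← inner_sub_right, ← real_inner_smul_left, hy, real_inner_comm, ← inner_mulVec_left,
        real_inner_comm]
      exact congrArg (⟪·, mulVec C (w - G)⟫) hz
    rw [h1, norm_sub_sq_real, hV]
    linarith
  constructor
  · intro hx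
    have h := (ENNReal.ofReal_le_ofReal_iff hV0).1 ((hge x).trans ((hx G).trans hle))
    have h0 : ‖mulVec C (x - G)‖ ^ 2 ≤ 0 := by
      by_contra! hcon
      linarith [mul_pos (half_pos hα) hcon]
    have h1 : ‖mulVec C (x - G)‖ = 0 := pow_eq_zero_iff two_ne_zero |>.1 (le_antisymm h0 (sq_nonneg _))
    have h2 := norm_le_div_sigmaMin C hC (x - G)
    rw [h1, zero_div] at h2
    exact sub_eq_zero.1 (norm_le_zero_iff.1 h2)
  · rintro rfl w
    refine hle.trans ((ENNReal.ofReal_le_ofReal ?_).trans (hge w))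
    exact le_add_of_nonneg_right (by positivity)

end Primal

section Empirical

variable {d : ℕ} {r : ℝ} {Ω : Type u}

theorem integral_empirical {V : Type*} [NormedAddCommGroup V] [NormedSpace ℝ V] [CompleteSpace V]
    (X : ℕ → Ω → EuclideanSpace ℝ (Fin d)) (n : ℕ) (ω : Ω) {f : EuclideanSpace ℝ (Fin d) → V} :
    ∫ x, f x ∂(empirical X n ω) = (n : ℝ)⁻¹ • ∑ i ∈ Finset.range n, f (X i ω) := by
  rw [empirical, integral_smul_measure, integral_finsetSum_measure fun i _ =>
    integrable_dirac (by simp)]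
  simp

theorem isProbabilityMeasure_empirical (X : ℕ → Ω → EuclideanSpace ℝ (Fin d)) {n : ℕ}
    (hn : 1 ≤ n) (ω : Ω) : IsProbabilityMeasure (empirical X n ω) := by
  constructor
  simp only [empirical, Measure.smul_apply, Measure.finsetSum_apply, measure_univ, smul_eq_mul]
  simp only [Finset.sum_const, Finset.card_range, nsmul_eq_mul, mul_one]
  exact ENNReal.inv_mul_cancel (by positivity) (ENNReal.natCast_ne_top n)

theorem ae_norm_le_empirical {X : ℕ → Ω → EuclideanSpace ℝ (Fin d)} (hX : ∀ i ω, ‖X i ω‖ ≤ r)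
    (n : ℕ) (ω : Ω) : ∀ᵐ x ∂(empirical X n ω), ‖x‖ ≤ r := by
  have hs : MeasurableSet {x : EuclideanSpace ℝ (Fin d) | ¬ ‖x‖ ≤ r} :=
    (measurableSet_le measurable_norm measurable_const).compl
  rw [ae_iff, empirical, Measure.smul_apply, Measure.finsetSum_apply,
    Finset.sum_eq_zero fun i _ => ?_, smul_zero]
  rw [Measure.dirac_apply' _ hs]
  simp [hX i ω]

end Empirical

section Sampling

variable {d : ℕ} {r : ℝ} {Ω : Type u} [MeasurableSpace Ω] {P : Measure Ω}

theorem integral_inner_eq_zero_of_indepFun [IsProbabilityMeasure P]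
    {Y Z : Ω → EuclideanSpace ℝ (Fin d)} (hY : Integrable Y P) (hZ : Integrable Z P)
    (hYZ : IndepFun Y Z P) (h0 : ∫ ω, Y ω ∂P = 0) : ∫ ω, ⟪Y ω, Z ω⟫ ∂P = 0 := by
  have h := hYZ.integral_bilin hY hZ (innerSL ℝ)
  rw [h0, map_zero] at h
  exact h

theorem integral_norm_sq_sum_le_of_indep [IsProbabilityMeasure P]
    {Y : ℕ → Ω → EuclideanSpace ℝ (Fin d)} {B : ℝ}
    (hm : ∀ i, Measurable (Y i)) (hB : ∀ i ω, ‖Y i ω‖ ≤ B) (h0 : ∀ i, ∫ ω, Y i ω ∂P = 0)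
    (hind : ∀ i j, i ≠ j → IndepFun (Y i) (Y j) P) (n : ℕ) :
    ∫ ω, ‖∑ i ∈ Finset.range n, Y i ω‖ ^ 2 ∂P ≤ n * B ^ 2 := by
  have hint : ∀ i, Integrable (Y i) P := fun i =>
    Integrable.of_bound (hm i).aestronglyMeasurable B (Filter.Eventually.of_forall (hB i))
  have hbound : ∀ i j ω, ⟪Y i ω, Y j ω⟫ ≤ B ^ 2 ∧ ‖⟪Y i ω, Y j ω⟫‖ ≤ B ^ 2 := by
    intro i j ω
    have h : ‖Y i ω‖ * ‖Y j ω‖ ≤ B ^ 2 := by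
      rw [sq]
      exact mul_le_mul (hB i ω) (hB j ω) (norm_nonneg _) ((norm_nonneg _).trans (hB i ω))
    exact ⟨(real_inner_le_norm _ _).trans h, (norm_inner_le_norm _ _).trans h⟩
  have hinner : ∀ i j, Integrable (fun ω => ⟪Y i ω, Y j ω⟫) P := fun i j =>
    Integrable.of_bound (((hm i).inner (hm j)).aestronglyMeasurable) (B ^ 2)
      (Filter.Eventually.of_forall fun ω => (hbound i j ω).2)
  have hcross : ∀ i j, ∫ ω, ⟪Y i ω, Y j ω⟫ ∂P ≤ if i = j then B ^ 2 else 0 := by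
    intro i j
    split_ifs with hij
    · have h := integral_mono (hinner i j) (integrable_const (B ^ 2)) fun ω => (hbound i j ω).1
      rwa [integral_const, probReal_univ, one_smul] at h
    · exact (integral_inner_eq_zero_of_indepFun (hint i) (hint j) (hind i j hij) (h0 i)).le
  calc ∫ ω, ‖∑ i ∈ Finset.range n, Y i ω‖ ^ 2 ∂P
      = ∫ ω, ∑ i ∈ Finset.range n, ∑ j ∈ Finset.range n, ⟪Y i ω, Y j ω⟫ ∂P := by
        congr 1 with ω
        rw [← real_inner_self_eq_norm_sq, sum_inner]
        simp only [inner_sum]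
    _ = ∑ i ∈ Finset.range n, ∑ j ∈ Finset.range n, ∫ ω, ⟪Y i ω, Y j ω⟫ ∂P := by
        rw [integral_finsetSum _ fun i _ => integrable_finsetSum _ fun j _ => hinner i j]
        exact Finset.sum_congr rfl fun i _ => integral_finsetSum _ fun j _ => hinner i j
    _ ≤ ∑ i ∈ Finset.range n, ∑ j ∈ Finset.range n, if i = j then B ^ 2 else 0 :=
        Finset.sum_le_sum fun i _ => Finset.sum_le_sum fun j _ => hcross i j
    _ = n * B ^ 2 := by
        rw [Finset.sum_congr rfl fun i hi => by rw [Finset.sum_ite_eq, if_pos hi]]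
        rw [Finset.sum_const, Finset.card_range, nsmul_eq_mul]

theorem integral_norm_sum_le_of_indep [IsProbabilityMeasure P]
    {Y : ℕ → Ω → EuclideanSpace ℝ (Fin d)} {B : ℝ}
    (hm : ∀ i, Measurable (Y i)) (hB : ∀ i ω, ‖Y i ω‖ ≤ B) (h0 : ∀ i, ∫ ω, Y i ω ∂P = 0)
    (hind : ∀ i j, i ≠ j → IndepFun (Y i) (Y j) P) (n : ℕ) :
    ∫ ω, ‖∑ i ∈ Finset.range n, Y i ω‖ ∂P ≤ B * √n := by
  obtain ⟨ω₀⟩ := nonempty_of_isProbabilityMeasure P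
  have hB0 : 0 ≤ B := (norm_nonneg _).trans (hB 0 ω₀)
  have hsecond := integral_norm_sq_sum_le_of_indep hm hB h0 hind n
  have hY : ∀ i ∈ Finset.range n, MemLp (Y i) 2 P := fun i _ =>
    MemLp.of_bound (hm i).aestronglyMeasurable B (Filter.Eventually.of_forall (hB i))
  have hmemLp : MemLp (fun ω => ‖∑ i ∈ Finset.range n, Y i ω‖) 2 P :=
    (memLp_finsetSum (Finset.range n) hY).norm
  have hvar := variance_nonneg (fun ω => ‖∑ i ∈ Finset.range n, Y i ω‖) P
  rw [variance_eq_sub hmemLp] at hvar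
  refine abs_le_of_sq_le_sq' ?_ (mul_nonneg hB0 (Real.sqrt_nonneg _)) |>.2
  rw [mul_pow, Real.sq_sqrt (Nat.cast_nonneg n)]
  simp only [Pi.pow_apply] at hvar
  linarith

theorem aemeasurable_tiltedMean_empirical {X : ℕ → Ω → EuclideanSpace ℝ (Fin d)}
    (hX : ∀ i, Measurable (X i)) (n : ℕ) {y : Ω → EuclideanSpace ℝ (Fin d)}
    (hy : AEMeasurable y P) : AEMeasurable (fun ω => tiltedMean (empirical X n ω) (y ω)) P := by
  have hX' : ∀ i, AEMeasurable (X i) P := fun i => (hX i).aemeasurable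
  have he : ∀ i, AEMeasurable (fun ω => Real.exp ⟪y ω, X i ω⟫) P := fun i =>
    Real.measurable_exp.comp_aemeasurable (hy.inner (hX' i))
  simp only [tiltedMean_eq, momentGen, integral_empirical]
  have h1 := (Finset.aemeasurable_fun_sum (Finset.range n) fun i _ => he i).const_smul (n : ℝ)⁻¹
  have h2 := (Finset.aemeasurable_fun_sum (Finset.range n)
    fun i _ => (he i).smul (hX' i)).const_smul (n : ℝ)⁻¹
  exact h1.inv.smul h2

theorem tiltedMean_sub_eq {ν : Measure (EuclideanSpace ℝ (Fin d))} [IsProbabilityMeasure ν]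
    (hν : ∀ᵐ x ∂ν, ‖x‖ ≤ r) (y a : EuclideanSpace ℝ (Fin d)) :
    tiltedMean ν y - a = (momentGen ν y)⁻¹ • ∫ x, Real.exp ⟪y, x⟫ • (x - a) ∂ν := by
  simp only [smul_sub]
  rw [integral_sub (integrable_exp_inner_smul hν y) ((integrable_exp_inner hν y).smul_const a),
    integral_smul_const, smul_sub, tiltedMean_eq, smul_smul]
  congr 1
  have h := inv_mul_cancel₀ (momentGen_pos hν y).ne'
  simp only [momentGen] at h ⊢
  rw [h, one_smul]

theorem exp_neg_le_momentGen {ν : Measure (EuclideanSpace ℝ (Fin d))} [IsProbabilityMeasure ν]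
    (hν : ∀ᵐ x ∂ν, ‖x‖ ≤ r) (y : EuclideanSpace ℝ (Fin d)) :
    Real.exp (-(r * ‖y‖)) ≤ momentGen ν y := by
  rw [← Real.le_log_iff_exp_le (momentGen_pos hν y)]
  exact neg_mul_norm_le_logMomentGen hν y

theorem integral_norm_tiltedMean_empirical_sub_le [IsProbabilityMeasure P]
    {X : ℕ → Ω → EuclideanSpace ℝ (Fin d)}
    {𝒳 : Set (EuclideanSpace ℝ (Fin d))} (hX : IsSample P 𝒳 X) (h𝒳 : ∀ x ∈ 𝒳, ‖x‖ ≤ r)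
    {n : ℕ} (hn : 1 ≤ n) (y : EuclideanSpace ℝ (Fin d)) :
    ∫ ω, ‖tiltedMean (empirical X n ω) y - tiltedMean (P.map (X 0)) y‖ ∂P ≤
      2 * r * Real.exp (2 * (r * ‖y‖)) * (1 / √(n : ℝ)) := by
  obtain ⟨ω₀⟩ := nonempty_of_isProbabilityMeasure P
  have hXr : ∀ i ω, ‖X i ω‖ ≤ r := fun i ω => h𝒳 _ (hX.mem i ω)
  have hr : 0 ≤ r := (norm_nonneg _).trans (hXr 0 ω₀)
  have hprob : IsProbabilityMeasure (P.map (X 0)) :=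
    Measure.isProbabilityMeasure_map (hX.measurable 0).aemeasurable
  have hμ : ∀ᵐ x ∂(P.map (X 0)), ‖x‖ ≤ r :=
    (ae_map_iff (hX.measurable 0).aemeasurable
      (measurableSet_le measurable_norm measurable_const)).2 (Filter.Eventually.of_forall (hXr 0))
  set F := tiltedMean (P.map (X 0)) y with hF
  have hFr : ‖F‖ ≤ r := norm_tiltedMean_le hμ y
  set g : EuclideanSpace ℝ (Fin d) → EuclideanSpace ℝ (Fin d) :=
    fun x => Real.exp ⟪y, x⟫ • (x - F) with hg
  have hgc : Continuous g := by fun_prop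
  have hgm : ∀ i, Measurable (fun ω => g (X i ω)) := fun i => hgc.measurable.comp (hX.measurable i)
  have hgB : ∀ i ω, ‖g (X i ω)‖ ≤ Real.exp (r * ‖y‖) * (r + r) := by
    intro i ω
    rw [hg, norm_smul, Real.norm_eq_abs, Real.abs_exp]
    exact mul_le_mul (Real.exp_le_exp.2 (le_of_abs_le (abs_inner_le_of_norm_le (hXr i ω))))
      ((norm_sub_le _ _).trans (add_le_add (hXr i ω) hFr)) (norm_nonneg _) (Real.exp_pos _).le
  have hg0 : ∀ i, ∫ ω, g (X i ω) ∂P = 0 := by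
    intro i
    have h1 : ∫ ω, g (X i ω) ∂P = ∫ ω, g (X 0 ω) ∂P :=
      ((hX.identDistrib i).comp hgc.measurable).integral_eq
    have h2 := tiltedMean_sub_eq hμ y F
    rw [← hF, sub_self, eq_comm, smul_eq_zero] at h2
    rw [h1, ← integral_map (hX.measurable 0).aemeasurable hgc.aestronglyMeasurable]
    exact h2.resolve_left (inv_ne_zero (momentGen_pos hμ y).ne')
  have hind : ∀ i j, i ≠ j → IndepFun (fun ω => g (X i ω)) (fun ω => g (X j ω)) P :=
    fun i j hij => (hX.indep.indepFun hij).comp hgc.measurable hgc.measurable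
  have hn0 : (0 : ℝ) < n := by exact_mod_cast hn
  have hpt : ∀ ω, ‖tiltedMean (empirical X n ω) y - F‖ ≤
      Real.exp (r * ‖y‖) * (n : ℝ)⁻¹ * ‖∑ i ∈ Finset.range n, g (X i ω)‖ := by
    intro ω
    have := isProbabilityMeasure_empirical X hn ω
    have hν := ae_norm_le_empirical hXr n ω
    rw [tiltedMean_sub_eq hν, integral_empirical, norm_smul, norm_smul, mul_assoc,
      Real.norm_of_nonneg (inv_pos.2 (momentGen_pos hν y)).le,
      Real.norm_of_nonneg (inv_pos.2 hn0).le]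
    refine mul_le_mul_of_nonneg_right ?_ (by positivity)
    rw [← inv_inv (Real.exp (r * ‖y‖)), ← Real.exp_neg]
    exact inv_anti₀ (Real.exp_pos _) (exp_neg_le_momentGen hν y)
  have hsum := integral_norm_sum_le_of_indep hgm hgB hg0 hind n
  have hint : Integrable (fun ω => ‖∑ i ∈ Finset.range n, g (X i ω)‖) P :=
    (integrable_finsetSum _ fun i _ => Integrable.of_bound (hgm i).aestronglyMeasurable _
      (Filter.Eventually.of_forall (hgB i))).norm
  have hsn : (n : ℝ)⁻¹ * √n = 1 / √n := by
    rw [inv_mul_eq_div, Real.sqrt_div_self']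
  calc _ ≤ ∫ ω, Real.exp (r * ‖y‖) * (n : ℝ)⁻¹ * ‖∑ i ∈ Finset.range n, g (X i ω)‖ ∂P :=
        integral_mono_of_nonneg (Filter.Eventually.of_forall fun ω => norm_nonneg _)
          (hint.const_mul _) (Filter.Eventually.of_forall hpt)
    _ = Real.exp (r * ‖y‖) * (n : ℝ)⁻¹ * ∫ ω, ‖∑ i ∈ Finset.range n, g (X i ω)‖ ∂P :=
        integral_const_mul _ _
    _ ≤ Real.exp (r * ‖y‖) * (n : ℝ)⁻¹ * (Real.exp (r * ‖y‖) * (r + r) * √n) :=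
        mul_le_mul_of_nonneg_left hsum (by positivity)
    _ = 2 * r * (Real.exp (r * ‖y‖) * Real.exp (r * ‖y‖)) * ((n : ℝ)⁻¹ * √n) := by ring
    _ = _ := by rw [← Real.exp_add, hsn, ← two_mul]

end Sampling

section Rate

variable {d m : ℕ} {r α ε : ℝ} {Ω : Type u} {X : ℕ → Ω → EuclideanSpace ℝ (Fin d)}
  {C : Matrix (Fin m) (Fin d) ℝ} {b : EuclideanSpace ℝ (Fin m)}

theorem norm_recover_empirical_sub_le (hX : ∀ i ω, ‖X i ω‖ ≤ r) (hr : 0 ≤ r) (hα : 0 < α)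
    (hC : C.rank = d) {μ : Measure (EuclideanSpace ℝ (Fin d))} {z w : EuclideanSpace ℝ (Fin m)}
    (hz : IsDualCritical μ C b α z) {n : ℕ} (hn : 1 ≤ n) (ω : Ω)
    (hw : w ∈ epsMinimizers (empirical X n ω) C b α ε) :
    ‖recover (empirical X n ω) C w - tiltedMean μ (mulVec C.transpose z)‖ ≤
      4 * r ^ 2 * specNorm C * √(2 * α) * √ε + specNorm C / sigmaMin C *
        ‖tiltedMean (empirical X n ω) (mulVec C.transpose z) -
          tiltedMean μ (mulVec C.transpose z)‖ := by
  have := isProbabilityMeasure_empirical X hn ω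
  have hν := ae_norm_le_empirical hX n ω
  obtain ⟨u, hu⟩ := exists_isDualCritical (C := C) (b := b) hr hν hα
  rw [recover_eq_tiltedMean hν]
  refine (norm_sub_le_norm_sub_add_norm_sub _ (tiltedMean (empirical X n ω)
    (mulVec C.transpose u)) _).trans (add_le_add ?_
      (norm_tiltedMean_sub_le_of_isDualCritical hν hα hC hz hu))
  calc _ ≤ 4 * r ^ 2 * ‖mulVec C.transpose w - mulVec C.transpose u‖ :=
        norm_tiltedMean_sub_le hr hν _ _
    _ ≤ 4 * r ^ 2 * (specNorm C * (√(2 * α) * √ε)) := by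
        refine mul_le_mul_of_nonneg_left ?_ (by positivity)
        rw [← mulVec_sub]
        exact (norm_mulVec_transpose_le C _).trans
          (mul_le_mul_of_nonneg_left (hu.norm_sub_le_sqrt hν hα hw) (specNorm_nonneg C))
    _ = _ := by ring

variable [MeasurableSpace Ω] {P : Measure Ω} [IsProbabilityMeasure P]
  {𝒳 : Set (EuclideanSpace ℝ (Fin d))}

theorem IsSample.isProbOn_map (hX : IsSample P 𝒳 X) (h𝒳 : MeasurableSet 𝒳) :
    IsProbOn 𝒳 (P.map (X 0)) := by
  refine ⟨Measure.isProbabilityMeasure_map (hX.measurable 0).aemeasurable, ?_⟩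
  rw [Measure.map_apply (hX.measurable 0) h𝒳.compl]
  convert measure_empty (μ := P)
  ext ω
  simp [hX.mem 0 ω]

theorem integrable_norm_recover_empirical_sub (hXm : ∀ i, Measurable (X i))
    (hX : ∀ i ω, ‖X i ω‖ ≤ r) {n : ℕ} (hn : 1 ≤ n) {z : Ω → EuclideanSpace ℝ (Fin m)}
    (hz : AEMeasurable z P) (a : EuclideanSpace ℝ (Fin d)) :
    Integrable (fun ω => ‖recover (empirical X n ω) C (z ω) - a‖) P := by
  have h : ∀ ω, recover (empirical X n ω) C (z ω) =
      tiltedMean (empirical X n ω) (mulVec C.transpose (z ω)) := fun ω =>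
    have := isProbabilityMeasure_empirical X hn ω
    recover_eq_tiltedMean (ae_norm_le_empirical hX n ω) _
  simp only [h]
  have hmeas := aemeasurable_tiltedMean_empirical hXm n
    ((continuous_mulVec C.transpose).measurable.comp_aemeasurable hz)
  refine ((Integrable.of_bound hmeas.aestronglyMeasurable r
    (Filter.Eventually.of_forall fun ω => ?_)).sub (integrable_const a)).norm
  have := isProbabilityMeasure_empirical X hn ω
  exact norm_tiltedMean_le (ae_norm_le_empirical hX n ω) _

theorem integral_norm_recover_empirical_sub_le (hX : IsSample P 𝒳 X) (h𝒳 : ∀ x ∈ 𝒳, ‖x‖ ≤ r)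
    (h𝒳m : MeasurableSet 𝒳) (hr : 0 ≤ r) (hα : 0 < α) (hC : C.rank = d)
    {zbar : EuclideanSpace ℝ (Fin m)} (hzbar : IsDualCritical (P.map (X 0)) C b α zbar) {n : ℕ}
    (hn : 1 ≤ n) {z : Ω → EuclideanSpace ℝ (Fin m)}
    (hz : ∀ ω, z ω ∈ epsMinimizers (empirical X n ω) C b α ε) :
    ∫ ω, ‖recover (empirical X n ω) C (z ω) -
        tiltedMean (P.map (X 0)) (mulVec C.transpose zbar)‖ ∂P ≤
      4 * r ^ 2 * specNorm C * √(2 * α) * √ε +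
        specNorm C * (2 * r * Real.exp (2 * (r * (specNorm C * (α * (‖b‖ + specNorm C * r)))))) /
          sigmaMin C * (1 / √(n : ℝ)) := by
  have hXr : ∀ i ω, ‖X i ω‖ ≤ r := fun i ω => h𝒳 _ (hX.mem i ω)
  have hμ := hX.isProbOn_map h𝒳m
  have := hμ.1
  set y := mulVec C.transpose zbar with hy
  set F := tiltedMean (P.map (X 0)) y with hF
  have hyle : ‖y‖ ≤ specNorm C * (α * (‖b‖ + specNorm C * r)) :=
    (norm_mulVec_transpose_le C zbar).trans
      (mul_le_mul_of_nonneg_left (hzbar.norm_le (hμ.ae_norm_le h𝒳) hα) (specNorm_nonneg C))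
  have hq : 0 ≤ specNorm C / sigmaMin C := div_nonneg (specNorm_nonneg C) (sigmaMin_nonneg C)
  have hint : Integrable (fun ω => ‖tiltedMean (empirical X n ω) y - F‖) P := by
    refine ((Integrable.of_bound (aemeasurable_tiltedMean_empirical hX.measurable n
      aemeasurable_const).aestronglyMeasurable r (Filter.Eventually.of_forall fun ω => ?_)).sub
        (integrable_const F)).norm
    have := isProbabilityMeasure_empirical X hn ω
    exact norm_tiltedMean_le (ae_norm_le_empirical hXr n ω) _
  calc _ ≤ ∫ ω, (4 * r ^ 2 * specNorm C * √(2 * α) * √ε +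
          specNorm C / sigmaMin C * ‖tiltedMean (empirical X n ω) y - F‖) ∂P :=
        integral_mono_of_nonneg (Filter.Eventually.of_forall fun ω => norm_nonneg _)
          ((integrable_const _).add (hint.const_mul _)) (Filter.Eventually.of_forall fun ω =>
            norm_recover_empirical_sub_le hXr hr hα hC hzbar hn ω (hz ω))
    _ = 4 * r ^ 2 * specNorm C * √(2 * α) * √ε +
          specNorm C / sigmaMin C * ∫ ω, ‖tiltedMean (empirical X n ω) y - F‖ ∂P := by
        rw [integral_add (integrable_const _) (hint.const_mul _), integral_const, probReal_univ,
          one_smul]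
        exact congrArg _ (integral_const_mul _ _)
    _ ≤ 4 * r ^ 2 * specNorm C * √(2 * α) * √ε + specNorm C / sigmaMin C *
          (2 * r * Real.exp (2 * (r * ‖y‖)) * (1 / √(n : ℝ))) :=
        add_le_add_right (mul_le_mul_of_nonneg_left
          (integral_norm_tiltedMean_empirical_sub_le hX h𝒳 hn y) hq) _
    _ ≤ 4 * r ^ 2 * specNorm C * √(2 * α) * √ε + specNorm C / sigmaMin C *
          (2 * r * Real.exp (2 * (r * (specNorm C * (α * (‖b‖ + specNorm C * r))))) *
            (1 / √(n : ℝ))) := by gcongr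
    _ = _ := by ring

end Rate

end MEM

theorem mainTheorem4 {d m : ℕ} (b : EuclideanSpace ℝ (Fin m)) (α : ℝ) (hα : 0 < α)
    (r c : ℝ) :
    ∃ K₁ K₂ D M : ℝ → ℝ, (∀ ε, 0 < K₁ ε ∧ 0 < K₂ ε ∧ 0 < D ε) ∧
      ∀ (C : Matrix (Fin m) (Fin d) ℝ), C.rank = d → MEM.specNorm C = c →
      ∀ (𝒳 : Set (EuclideanSpace ℝ (Fin d))), IsCompact 𝒳 → IsGreatest (norm '' 𝒳) r →
      ∀ (Ω : Type u) [MeasurableSpace Ω] (P : Measure Ω) [IsProbabilityMeasure P]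
        (X : ℕ → Ω → EuclideanSpace ℝ (Fin d)), MEM.IsSample P 𝒳 X →
      ∃ xbar : EuclideanSpace ℝ (Fin d),
        (∀ x, MEM.IsPrimalSolution 𝒳 (P.map (X 0)) C b α x ↔ x = xbar) ∧
        ∀ (ε : ℝ), 0 ≤ ε → ∀ (n : ℕ), 1 ≤ n →
        ∀ (z : Ω → EuclideanSpace ℝ (Fin m)), AEMeasurable z P →
          (∀ ω, z ω ∈ MEM.epsMinimizers (MEM.empirical X n ω) C b α ε) →
          Integrable (fun ω => ‖MEM.recover (MEM.empirical X n ω) C (z ω) - xbar‖) P ∧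
          ∫ ω, ‖MEM.recover (MEM.empirical X n ω) C (z ω) - xbar‖ ∂P ≤
            D ε * K₁ ε / (α * MEM.sigmaMin C) * (1 / √(n : ℝ)) +
            2 * D ε * √(2 * K₁ ε) / (√α * MEM.sigmaMin C) * √(1 / √(n : ℝ)) +
            (K₂ ε * MEM.specNorm C * √(2 * α) + 2 / (√α * MEM.sigmaMin C)) * √ε ∧
          ∫ ω, ‖MEM.recover (MEM.empirical X n ω) C (z ω) - xbar‖ ∂P ≤
            M (MEM.sigmaMin C) * (1 / (n : ℝ) ^ (1 / 4 : ℝ) + √ε) := by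
  set A : ℝ := c * (2 * r * Real.exp (2 * (r * (c * (α * (‖b‖ + c * r)))))) with hA
  refine ⟨fun _ => 1, fun _ => 4 * r ^ 2 + 1, fun _ => α * |A| + 1,
    fun σ => A / σ + 4 * r ^ 2 * c * √(2 * α), fun _ => ⟨one_pos, by positivity, by positivity⟩, ?_⟩
  intro C hC hc 𝒳 h𝒳c h𝒳r Ω _ P _ X hX
  have h𝒳 : ∀ x ∈ 𝒳, ‖x‖ ≤ r := fun x hx => h𝒳r.2 ⟨x, hx, rfl⟩
  have hr : 0 ≤ r := by
    obtain ⟨x, _, hx⟩ := h𝒳r.1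
    exact hx ▸ norm_nonneg x
  have hc0 : 0 ≤ c := hc ▸ MEM.specNorm_nonneg C
  have hσ := MEM.sigmaMin_nonneg C
  have hA0 : 0 ≤ A := by positivity
  have hμ := hX.isProbOn_map h𝒳c.measurableSet
  have := hμ.1
  obtain ⟨zbar, hzbar⟩ :=
    MEM.exists_isDualCritical (C := C) (b := b) hr (hμ.ae_norm_le h𝒳) hα
  refine ⟨_, hzbar.isPrimalSolution_iff h𝒳 hμ hα hC, fun ε hε n hn z hzm hz => ?_⟩
  have hmain := MEM.integral_norm_recover_empirical_sub_le hX h𝒳 h𝒳c.measurableSet hr hα hC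
    hzbar hn hz
  rw [hc, ← hA] at hmain
  have hn1 : (1 : ℝ) ≤ n := by exact_mod_cast hn
  refine ⟨MEM.integrable_norm_recover_empirical_sub hX.measurable
    (fun i ω => h𝒳 _ (hX.mem i ω)) hn hzm _, hmain.trans ?_, hmain.trans ?_⟩
  · have h1 : A / MEM.sigmaMin C ≤ (α * |A| + 1) * 1 / (α * MEM.sigmaMin C) := by
      rw [← mul_div_mul_left A (MEM.sigmaMin C) hα.ne', abs_of_nonneg hA0]
      exact div_le_div_of_nonneg_right (by linarith) (by positivity)
    have h2 := mul_le_mul_of_nonneg_right h1 (show 0 ≤ 1 / √(n : ℝ) by positivity)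
    have h3 : 0 ≤ 2 * (α * |A| + 1) * √(2 * 1) / (√α * MEM.sigmaMin C) * √(1 / √(n : ℝ)) := by
      positivity
    have h4 : 0 ≤ c * √(2 * α) * √ε := by positivity
    have h5 : 0 ≤ 2 / (√α * MEM.sigmaMin C) * √ε := by positivity
    rw [hc]
    linarith
  · have h1 : 1 / √(n : ℝ) ≤ 1 / (n : ℝ) ^ (1 / 4 : ℝ) := by
      rw [Real.sqrt_eq_rpow]
      exact one_div_le_one_div_of_le (by positivity)
        (Real.rpow_le_rpow_of_exponent_le hn1 (by norm_num))
    have h2 := mul_le_mul_of_nonneg_left h1 (show 0 ≤ A / MEM.sigmaMin C by positivity)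
    have h3 : 0 ≤ A / MEM.sigmaMin C * √ε := by positivity
    have h4 : 0 ≤ 4 * r ^ 2 * c * √(2 * α) * (1 / (n : ℝ) ^ (1 / 4 : ℝ)) := by positivity
    linarith
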